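/- Let $0<q<1$ and $\nu>-1$ be real. Let $$J_\nu(z;q^2)=z^{\nu}\,\frac{(q^{2\nu+2};q^2)_\infty}{(q^2;q^2)_\infty}\sum_{n=0}^{\infty}(-1)^n\frac{q^{n(n+1)}}{(q^{2\nu+2};q^2)_n\,(q^2;q^2)_n}\,z^{2n}\qquad(z>0)$$ be the third Jackson (Hahn--Exton) $q$-Bessel function, where $(a;p)_n=\prod_{i=0}^{n-1}(1-ap^i)$ and $(a;p)_\infty=\prod_{i=0}^{\infty}(1-ap^i)$, and let $j_{1\nu}<j_{2\nu}<\cdots$ be the positive zeros of $z\mapsto J_\nu(z;q^2)$ in increasing order. Let $\varepsilon_k^{(\nu)}$ be the real number defined by $j_{k\nu}=q^{-k+\varepsilon_k^{(\nu)}}$, and, for all large $k$, put $$\alpha_k^{(\nu)}=\frac{\log\left(1-\frac{q^{2(k+\nu)}}{1-q^{2k}}\right)}{2\log q}.$$ (i) The sequence $\varepsilon_k^{(\nu)}$ is eventually strictly decreasing: there is a positive integer $k_0$ (depending on $q$ and $\nu$) such that $\varepsilon_{k+1}^{(\nu)}<\varepsilon_k^{(\nu)}$ for all $k\ge k_0$.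 (ii) For all sufficiently large $k$, $$q^{-k-1+\alpha_{k+1}^{(\nu)}}<\frac{j_{k\nu}}{q}<j_{k+1,\nu}.$$ -/

import Mathlib

noncomputable section

/-- The finite `q`-shifted factorial `(a; q)_n = (1 - a)(1 - a q) ⋯ (1 - a q ^ (n - 1))`. -/
def qShiftedFactorial (a q : ℝ) (n : ℕ) : ℝ :=
  ∏ i ∈ Finset.range n, (1 - a * q ^ i)

/-- The infinite `q`-shifted factorial `(a; q)_∞`; the product converges for `|q| < 1`. -/
def qShiftedFactorialInf (a q : ℝ) : ℝ :=
  ∏' i : ℕ, (1 - a * q ^ i)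

/-- The third Jackson (Hahn-Exton) `q`-Bessel function `J_ν(z; q)`, for `z > 0`, `0 < q < 1`
and `ν > -1`. -/
def hahnExtonBessel (ν q z : ℝ) : ℝ :=
  z ^ ν * (qShiftedFactorialInf (q ^ (ν + 1)) q / qShiftedFactorialInf q q) *
    ∑' n : ℕ, (-1) ^ n * (q ^ (n * (n + 1) / 2) /
      (qShiftedFactorial (q ^ (ν + 1)) q n * qShiftedFactorial q q n)) * z ^ (2 * n)

/-- The `k`-th positive zero `j_{kν}` (`k ≥ 1`) of `z ↦ J_ν(z; q²)`, in increasing order: the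
least zero greater than the preceding one. The value at `k = 0` is the starting point `0`
of the recursion, not a zero. -/
def besselZero (ν q : ℝ) : ℕ → ℝ
  | 0 => 0
  | k + 1 => sInf {z : ℝ | besselZero ν q k < z ∧ hahnExtonBessel ν (q ^ 2) z = 0}

/-- The number `ε_k` determined by `j_{kν} = q ^ (-k + ε_k)`. -/
def besselZeroEps (ν q : ℝ) (k : ℕ) : ℝ :=
  (k : ℝ) + Real.logb q (besselZero ν q k)

/-- `α_k = log (1 - q^(2(k+ν)) / (1 - q^(2k))) / (2 log q)`; the argument of the outer logarithm
is positive for all large `k`. -/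
def besselAlpha (ν q : ℝ) (k : ℕ) : ℝ :=
  Real.log (1 - q ^ (2 * ((k : ℝ) + ν)) / (1 - q ^ (2 * k))) / (2 * Real.log q)

end

open Filter Topology

/-! Put p = q² and a = p^(ν+1). The positive zeros of J_ν(·; q²) are the square roots of the
positive zeros w₁ < w₂ < ... of the entire function f = `qBesselSeries a p`. Iterating the
three-term recurrence between f(x), f(px), f(p²x) gives a Christoffel-Darboux identity
(`qBesselSeries_cross_sub`) whose kernel is a sum of squares on the diagonal, so f(x)/f(px) has
slope at most -p between its poles (`qBesselSeries_ratio_le`). This quotient vanishes at w_k and has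
no pole before px reaches w_k; hence w_k/p < w_{k+1}. That is the upper half of (ii), and its
logarithm is (i), for every k ≥ 1.

For the lower half let u_k = p^k w_k. After squaring, the claim reads u_k > 1 - a p^k/(1 - p^(k+1)),
and even u_k > 1 - a p^k holds eventually. Comparing the zeros for the parameters a and ap, together
with positivity of f for tiny parameters, puts u_k eventually above any d < 1
(`eventually_lt_pow_mul_qBesselSeriesZero`). The slope bound, used quantitatively, gives u_{k+1} -
u_k ≤ C p^(2k) (`qBesselSeriesZero_gap_le`). Summing, u_k ≥ 1 - C' p^(2k), which beats 1 - a p^k. -/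

/-- The coefficients of the power series of the Hahn-Exton `q`-Bessel function. -/
noncomputable def qBesselCoeff (a p : ℝ) (n : ℕ) : ℝ :=
  (-1) ^ n * (p ^ (n * (n + 1) / 2) / (qShiftedFactorial a p n * qShiftedFactorial p p n))

/-- The entire function `∑ (-1)ⁿ p^(n(n+1)/2) xⁿ / ((a; p)ₙ (p; p)ₙ)`. -/
noncomputable def qBesselSeries (a p x : ℝ) : ℝ := ∑' n : ℕ, qBesselCoeff a p n * x ^ n

/-! ### Coefficients, convergence and continuity of the series. -/

lemma one_sub_mul_pow_pos {a p : ℝ} (hp0 : 0 < p) (hp1 : p < 1) (ha1 : a < 1) (n : ℕ) :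
    0 < 1 - a * p ^ n := by
  have h1 : p ^ n ≤ 1 := pow_le_one₀ hp0.le hp1.le
  have h2 : 0 < p ^ n := by positivity
  nlinarith

lemma qShiftedFactorial_pos {a p : ℝ} (hp0 : 0 < p) (hp1 : p < 1) (ha1 : a < 1) (n : ℕ) :
    0 < qShiftedFactorial a p n :=
  Finset.prod_pos fun i _ => one_sub_mul_pow_pos hp0 hp1 ha1 i

lemma qShiftedFactorial_succ (a p : ℝ) (n : ℕ) :
    qShiftedFactorial a p (n + 1) = qShiftedFactorial a p n * (1 - a * p ^ n) :=
  Finset.prod_range_succ _ _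

lemma qShiftedFactorial_succ' (a p : ℝ) (n : ℕ) :
    qShiftedFactorial a p (n + 1) = (1 - a) * qShiftedFactorial (a * p) p n := by
  unfold qShiftedFactorial
  rw [Finset.prod_range_succ', mul_comm]
  simp [pow_succ', mul_assoc]

lemma qBesselCoeff_zero (a p : ℝ) : qBesselCoeff a p 0 = 1 := by
  simp [qBesselCoeff, qShiftedFactorial]

lemma triangle_succ (n : ℕ) : (n + 1) * (n + 1 + 1) / 2 = n * (n + 1) / 2 + (n + 1) := by
  rw [show (n + 1) * (n + 1 + 1) = n * (n + 1) + (n + 1) * 2 by ring,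
    Nat.add_mul_div_right _ _ (by norm_num)]

section

variable {a p : ℝ}

lemma qBesselCoeff_succ (hp0 : 0 < p) (hp1 : p < 1) (ha1 : a < 1) (n : ℕ) :
    qBesselCoeff a p (n + 1) * ((1 - a * p ^ n) * (1 - p ^ (n + 1))) =
      -p ^ (n + 1) * qBesselCoeff a p n := by
  have h1 := (qShiftedFactorial_pos hp0 hp1 ha1 n).ne'
  have h2 := (qShiftedFactorial_pos hp0 hp1 hp1 n).ne'
  have h3 := (one_sub_mul_pow_pos hp0 hp1 ha1 n).ne'
  have h4 := (one_sub_mul_pow_pos hp0 hp1 hp1 n).ne'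
  rw [← pow_succ'] at h4
  unfold qBesselCoeff
  rw [triangle_succ, qShiftedFactorial_succ, qShiftedFactorial_succ, ← pow_succ' p n]
  field_simp
  ring

lemma qBesselCoeff_succ_shift (hp0 : 0 < p) (hp1 : p < 1) (ha1 : a < 1) (n : ℕ) :
    qBesselCoeff a p (n + 1) * (1 - p ^ (n + 1)) =
      -(p / (1 - a)) * (p ^ n * qBesselCoeff (a * p) p n) := by
  have hap : a * p < 1 := by nlinarith
  have h1 := (qShiftedFactorial_pos hp0 hp1 hap n).ne'
  have h2 := (qShiftedFactorial_pos hp0 hp1 hp1 n).ne'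
  have h3 : 1 - a ≠ 0 := by linarith
  have h4 := (one_sub_mul_pow_pos hp0 hp1 hp1 n).ne'
  unfold qBesselCoeff
  rw [triangle_succ, qShiftedFactorial_succ', qShiftedFactorial_succ]
  rw [show (1 : ℝ) - p ^ (n + 1) = 1 - p * p ^ n by ring]
  field_simp
  ring

lemma summable_qBesselCoeff (hp0 : 0 < p) (hp1 : p < 1) (ha1 : a < 1) (x : ℝ) :
    Summable fun n => qBesselCoeff a p n * x ^ n := by
  have hlim : Tendsto (fun n : ℕ => p ^ (n + 1) * |x|) atTop (𝓝 0) := by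
    have := ((tendsto_pow_atTop_nhds_zero_of_lt_one hp0.le hp1).comp
      (tendsto_add_atTop_nat 1)).mul_const |x|
    simpa using this
  obtain ⟨δ, hδ0, hδ⟩ : ∃ δ : ℝ, 0 < δ ∧ ∀ n : ℕ, δ ≤ (1 - a * p ^ n) * (1 - p ^ (n + 1)) := by
    refine ⟨min (1 - a) 1 * (1 - p), mul_pos (lt_min (by linarith) one_pos) (by linarith), fun n => ?_⟩
    have hpn : p ^ n ≤ 1 := pow_le_one₀ hp0.le hp1.le
    have hpn0 : 0 < p ^ n := by positivity
    refine mul_le_mul ?_ ?_ (by linarith) (one_sub_mul_pow_pos hp0 hp1 ha1 n).le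
    · rcases le_total a 0 with h | h
      · exact (min_le_right _ _).trans (by nlinarith)
      · exact (min_le_left _ _).trans (by nlinarith)
    · rw [pow_succ]; nlinarith
  refine summable_of_ratio_norm_eventually_le (r := 1 / 2) (by norm_num) ?_
  filter_upwards [hlim.eventually (gt_mem_nhds (show 0 < δ / 2 by positivity))] with n hn
  have hs := qBesselCoeff_succ hp0 hp1 ha1 n
  have hd := hδ n
  set d := (1 - a * p ^ n) * (1 - p ^ (n + 1)) with hdef
  have hdpos : 0 < d := hδ0.trans_le hd
  have hs' : |qBesselCoeff a p (n + 1)| * d = p ^ (n + 1) * |qBesselCoeff a p n| := by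
    rw [← abs_of_pos hdpos, ← abs_mul, hs, abs_mul, abs_neg, abs_of_pos (pow_pos hp0 _)]
  rw [Real.norm_eq_abs, Real.norm_eq_abs, abs_mul, abs_mul, abs_pow, abs_pow]
  have hc : 0 ≤ |qBesselCoeff a p n| * |x| ^ n := by positivity
  refine le_of_mul_le_mul_right ?_ hdpos
  calc |qBesselCoeff a p (n + 1)| * |x| ^ (n + 1) * d
      = (|qBesselCoeff a p (n + 1)| * d) * |x| ^ (n + 1) := by ring
    _ = (p ^ (n + 1) * |x|) * (|qBesselCoeff a p n| * |x| ^ n) := by rw [hs']; ring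
    _ ≤ (d / 2) * (|qBesselCoeff a p n| * |x| ^ n) := by gcongr; linarith
    _ = 1 / 2 * (|qBesselCoeff a p n| * |x| ^ n) * d := by ring

lemma hasSum_qBesselSeries (hp0 : 0 < p) (hp1 : p < 1) (ha1 : a < 1) (x : ℝ) :
    HasSum (fun n => qBesselCoeff a p n * x ^ n) (qBesselSeries a p x) :=
  (summable_qBesselCoeff hp0 hp1 ha1 x).hasSum

lemma qBesselSeries_zero (a p : ℝ) : qBesselSeries a p 0 = 1 := by
  unfold qBesselSeries
  rw [tsum_eq_single 0 (fun n hn => by simp [hn])]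
  simp [qBesselCoeff_zero]

lemma continuous_qBesselSeries (hp0 : 0 < p) (hp1 : p < 1) (ha1 : a < 1) :
    Continuous (qBesselSeries a p) := by
  rw [continuous_iff_continuousAt]
  intro x
  have h : ContinuousOn (qBesselSeries a p) (Metric.ball 0 (|x| + 1)) := by
    refine continuousOn_tsum (u := fun n => ‖qBesselCoeff a p n * (|x| + 1) ^ n‖)
      (fun n => by fun_prop) (summable_qBesselCoeff hp0 hp1 ha1 _).norm fun n y hy => ?_
    have hy' : |y| < |x| + 1 := by simpa using hy
    have hx1 : |(|x| + 1)| = |x| + 1 := abs_of_nonneg (by positivity)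
    rw [norm_mul, norm_mul, norm_pow, norm_pow, Real.norm_eq_abs y, Real.norm_eq_abs (|x| + 1), hx1]
    gcongr
  exact h.continuousAt (Metric.isOpen_ball.mem_nhds (by simp))

/-! ### The q-difference equations. -/

lemma qBesselSeries_sub (hp0 : 0 < p) (hp1 : p < 1) (ha1 : a < 1) (x : ℝ) :
    qBesselSeries a p x - qBesselSeries a p (p * x) =
      -(p / (1 - a)) * x * qBesselSeries (a * p) p (p * x) := by
  have hap : a * p < 1 := by nlinarith
  have h1 := (hasSum_qBesselSeries hp0 hp1 ha1 x).sub (hasSum_qBesselSeries hp0 hp1 ha1 (p * x))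
  have h2 := (hasSum_qBesselSeries hp0 hp1 hap (p * x)).mul_left (-(p / (1 - a)) * x)
  refine h1.unique ?_
  rw [← hasSum_nat_add_iff' 1, Finset.sum_range_one, pow_zero, pow_zero, sub_self, sub_zero]
  refine h2.congr_fun fun n => ?_
  have := qBesselCoeff_succ_shift hp0 hp1 ha1 n
  calc _ = (qBesselCoeff a p (n + 1) * (1 - p ^ (n + 1))) * x ^ (n + 1) := by ring
    _ = _ := by rw [this]; ring

lemma qBesselSeries_recurrence (hp0 : 0 < p) (hp1 : p < 1) (ha1 : a < 1) (x : ℝ) :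
    qBesselSeries a p x = (1 + a / p - p * x) * qBesselSeries a p (p * x) -
      a / p * qBesselSeries a p (p * (p * x)) := by
  have h0 := hasSum_qBesselSeries hp0 hp1 ha1 x
  have h1 := hasSum_qBesselSeries hp0 hp1 ha1 (p * x)
  have h2 := hasSum_qBesselSeries hp0 hp1 ha1 (p * (p * x))
  have h3 := (h0.sub (h1.mul_left (1 + a / p))).add (h2.mul_left (a / p))
  have h4 := h1.mul_left (-(p * x))
  have key : qBesselSeries a p x - (1 + a / p) * qBesselSeries a p (p * x) +
      a / p * qBesselSeries a p (p * (p * x)) = -(p * x) * qBesselSeries a p (p * x) := by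
    refine h3.unique ?_
    rw [← hasSum_nat_add_iff' 1, Finset.sum_range_one, pow_zero, pow_zero, pow_zero,
      show ∀ u v c : ℝ, c - (u - (1 + v) * u + v * u) = c by intros; ring]
    refine h4.congr_fun fun n => ?_
    have := qBesselCoeff_succ hp0 hp1 ha1 n
    calc _ = (qBesselCoeff a p (n + 1) * ((1 - a * p ^ n) * (1 - p ^ (n + 1)))) * x ^ (n + 1) := by
          field_simp; ring
      _ = _ := by rw [this]; ring
  linarith

/-! ### The Christoffel-Darboux identity and the quotient f(x)/f(px). -/

/-- The sum in the Christoffel-Darboux type identity for `qBesselSeries`. -/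
noncomputable def qBesselKernel (a p x y : ℝ) : ℝ :=
  ∑' n : ℕ, a ^ n * (qBesselSeries a p (p ^ (n + 1) * x) * qBesselSeries a p (p ^ (n + 1) * y))

lemma exists_abs_qBesselSeries_le (hp0 : 0 < p) (hp1 : p < 1) (ha1 : a < 1) (R : ℝ) :
    ∃ B : ℝ, 0 ≤ B ∧ ∀ x : ℝ, |x| ≤ R → ∀ n : ℕ, |qBesselSeries a p (p ^ n * x)| ≤ B := by
  obtain ⟨B, hB⟩ := (isCompact_Icc (a := -R) (b := R)).exists_bound_of_continuousOn
    (continuous_qBesselSeries hp0 hp1 ha1).continuousOn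
  refine ⟨max B 0, le_max_right _ _, fun x hx n => (hB _ ?_).trans (le_max_left _ _)⟩
  rw [Set.mem_Icc, ← abs_le]
  rw [abs_mul, abs_of_pos (pow_pos hp0 n)]
  have : p ^ n ≤ 1 := pow_le_one₀ hp0.le hp1.le
  nlinarith [abs_nonneg x]

lemma summable_qBesselKernel (hp0 : 0 < p) (hp1 : p < 1) (ha0 : 0 < a) (ha1 : a < 1) (x y : ℝ) :
    Summable fun n : ℕ =>
      a ^ n * (qBesselSeries a p (p ^ (n + 1) * x) * qBesselSeries a p (p ^ (n + 1) * y)) := by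
  obtain ⟨B, hB0, hB⟩ := exists_abs_qBesselSeries_le hp0 hp1 ha1 (max |x| |y|)
  refine Summable.of_norm_bounded ((summable_geometric_of_lt_one ha0.le ha1).mul_right (B * B))
    fun n => ?_
  rw [norm_mul, norm_mul, Real.norm_eq_abs, Real.norm_eq_abs, Real.norm_eq_abs,
    abs_of_pos (pow_pos ha0 n)]
  have h1 := hB x (le_max_left _ _) (n + 1)
  have h2 := hB y (le_max_right _ _) (n + 1)
  gcongr

lemma continuous_qBesselKernel (hp0 : 0 < p) (hp1 : p < 1) (ha0 : 0 < a) (ha1 : a < 1) (y : ℝ) :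
    Continuous fun x => qBesselKernel a p x y := by
  rw [continuous_iff_continuousAt]
  intro x
  obtain ⟨B, hB0, hB⟩ := exists_abs_qBesselSeries_le hp0 hp1 ha1 (max (|x| + 1) |y|)
  have hc := continuous_qBesselSeries hp0 hp1 ha1
  have h : ContinuousOn (fun x => qBesselKernel a p x y) (Metric.ball 0 (|x| + 1)) := by
    refine continuousOn_tsum (u := fun n => a ^ n * (B * B)) (fun n => by fun_prop)
      ((summable_geometric_of_lt_one ha0.le ha1).mul_right (B * B)) fun n z hz => ?_
    have hz' : |z| < |x| + 1 := by simpa using hz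
    rw [norm_mul, norm_mul, Real.norm_eq_abs, Real.norm_eq_abs, Real.norm_eq_abs,
      abs_of_pos (pow_pos ha0 n)]
    have h1 := hB z (hz'.le.trans (le_max_left _ _)) (n + 1)
    have h2 := hB y (le_max_right _ _) (n + 1)
    gcongr
  exact h.continuousAt (Metric.isOpen_ball.mem_nhds (by simp))

lemma tendsto_qBesselSeries_pow_mul (hp0 : 0 < p) (hp1 : p < 1) (ha1 : a < 1) (x : ℝ) :
    Tendsto (fun n : ℕ => qBesselSeries a p (p ^ n * x)) atTop (𝓝 1) := by
  have h1 : Tendsto (fun n : ℕ => p ^ n * x) atTop (𝓝 0) := by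
    simpa using (tendsto_pow_atTop_nhds_zero_of_lt_one hp0.le hp1).mul_const x
  have := ((continuous_qBesselSeries hp0 hp1 ha1).tendsto 0).comp h1
  rwa [qBesselSeries_zero] at this

lemma qBesselSeries_cross_sub (hp0 : 0 < p) (hp1 : p < 1) (ha0 : 0 < a) (ha1 : a < 1) (x y : ℝ) :
    qBesselSeries a p x * qBesselSeries a p (p * y) -
      qBesselSeries a p y * qBesselSeries a p (p * x) = p * (y - x) * qBesselKernel a p x y := by
  have hap : a * p < 1 := by nlinarith
  set f := qBesselSeries a p with hf
  have hfin : ∀ N : ℕ, f x * f (p * y) - f y * f (p * x) =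
      p * (y - x) * ∑ n ∈ Finset.range N, a ^ n * (f (p ^ (n + 1) * x) * f (p ^ (n + 1) * y)) +
      (a / p) ^ N * (f (p ^ N * x) * f (p * (p ^ N * y)) - f (p ^ N * y) * f (p * (p ^ N * x))) := by
    intro N
    induction N with
    | zero => simp
    | succ N ih =>
      rw [ih, Finset.sum_range_succ]
      have e1 := qBesselSeries_recurrence hp0 hp1 ha1 (p ^ N * x)
      have e2 := qBesselSeries_recurrence hp0 hp1 ha1 (p ^ N * y)
      rw [← hf] at e1 e2
      have e3 : ∀ z, p ^ (N + 1) * z = p * (p ^ N * z) := fun z => by ring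
      rw [e3, e3, e1, e2, pow_succ (a / p)]
      have e4 : (a / p) ^ N * p ^ N = a ^ N := by
        rw [div_pow]; field_simp
      rw [← e4]
      ring
  -- Since a/p may be at least 1 (when ν ≤ 0), boundedness of the bracket is not enough. By
  -- `qBesselSeries_sub` the bracket is p^N times a bounded factor, and (a/p)^N p^N = a^N tends to
  -- 0.
  have hrem : Tendsto (fun N : ℕ => (a / p) ^ N *
      (f (p ^ N * x) * f (p * (p ^ N * y)) - f (p ^ N * y) * f (p * (p ^ N * x)))) atTop (𝓝 0) := by
    have hg := fun z => (tendsto_qBesselSeries_pow_mul hp0 hp1 hap z).comp (tendsto_add_atTop_nat 1)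
    have hf' := fun z => (tendsto_qBesselSeries_pow_mul hp0 hp1 ha1 z).comp (tendsto_add_atTop_nat 1)
    have ht := (tendsto_pow_atTop_nhds_zero_of_lt_one ha0.le ha1).mul
      (((((hg x).mul (hf' y)).mul_const x).sub (((hg y).mul (hf' x)).mul_const y)).mul_const
        (-(p / (1 - a))))
    rw [zero_mul] at ht
    refine ht.congr fun N => ?_
    have e1 := qBesselSeries_sub hp0 hp1 ha1 (p ^ N * x)
    have e2 := qBesselSeries_sub hp0 hp1 ha1 (p ^ N * y)
    have e4 : (a / p) ^ N * p ^ N = a ^ N := by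
      rw [div_pow]; field_simp
    have e3 : ∀ z, p ^ (N + 1) * z = p * (p ^ N * z) := fun z => by ring
    simp only [Function.comp, e3]
    rw [sub_eq_iff_eq_add] at e1 e2
    rw [← hf] at e1 e2 ⊢
    rw [e1, e2, ← e4]
    ring
  have hlim := ((summable_qBesselKernel hp0 hp1 ha0 ha1 x y).hasSum.tendsto_sum_nat.const_mul
    (p * (y - x))).add hrem
  rw [add_zero] at hlim
  refine tendsto_nhds_unique (tendsto_const_nhds.congr hfin) hlim

lemma le_qBesselKernel_self (hp0 : 0 < p) (hp1 : p < 1) (ha0 : 0 < a) (ha1 : a < 1) (x : ℝ) (n : ℕ) :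
    a ^ n * (qBesselSeries a p (p ^ (n + 1) * x)) ^ 2 ≤ qBesselKernel a p x x := by
  rw [pow_two]
  exact (summable_qBesselKernel hp0 hp1 ha0 ha1 x x).le_tsum n
    fun m _ => mul_nonneg (by positivity) (mul_self_nonneg _)

lemma qBesselKernel_self_pos (hp0 : 0 < p) (hp1 : p < 1) (ha0 : 0 < a) (ha1 : a < 1) (x : ℝ) :
    0 < qBesselKernel a p x x := by
  have h := (tendsto_qBesselSeries_pow_mul hp0 hp1 ha1 x).comp (tendsto_add_atTop_nat 1)
  obtain ⟨n, hn⟩ := (h.eventually (lt_mem_nhds zero_lt_one)).exists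
  refine lt_of_lt_of_le ?_ (le_qBesselKernel_self hp0 hp1 ha0 ha1 x n)
  have : 0 < qBesselSeries a p (p ^ (n + 1) * x) := hn
  positivity

/-- The quotient `f(x) / f(px)` decreases with slope at most `-p` between its poles. -/
lemma qBesselSeries_ratio_le (hp0 : 0 < p) (hp1 : p < 1) (ha0 : 0 < a) (ha1 : a < 1) {x y : ℝ}
    (hxy : x ≤ y) (hne : ∀ t ∈ Set.Icc x y, qBesselSeries a p (p * t) ≠ 0) :
    qBesselSeries a p y / qBesselSeries a p (p * y) ≤
      qBesselSeries a p x / qBesselSeries a p (p * x) - p * (y - x) := by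
  set f := qBesselSeries a p with hf
  have hc : Continuous f := continuous_qBesselSeries hp0 hp1 ha1
  -- The identity turns the difference quotient into -p K(s,t) / (f(ps) f(pt)), so continuity of the
  -- kernel yields the derivative without differentiating the series.
  have hd : ∀ t ∈ Set.Icc x y, HasDerivAt (fun s => f s / f (p * s))
      (-p * qBesselKernel a p t t / (f (p * t) * f (p * t))) t := by
    intro t ht
    rw [hasDerivAt_iff_tendsto_slope]
    have hcont : ContinuousAt
        (fun s => -p * qBesselKernel a p s t / (f (p * s) * f (p * t))) t := by
      have := (continuous_qBesselKernel hp0 hp1 ha0 ha1 t).continuousAt (x := t)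
      refine ContinuousAt.div (by fun_prop) (by fun_prop) ?_
      exact mul_ne_zero (hne t ht) (hne t ht)
    refine (hcont.tendsto.mono_left nhdsWithin_le_nhds).congr' ?_
    have hev : ∀ᶠ s in 𝓝[≠] t, f (p * s) ≠ 0 :=
      nhdsWithin_le_nhds ((by fun_prop : Continuous fun s => f (p * s)).continuousAt.eventually_ne
        (hne t ht))
    filter_upwards [hev, self_mem_nhdsWithin] with s hs hst
    have hst' : s - t ≠ 0 := sub_ne_zero.2 hst
    have hcr := qBesselSeries_cross_sub hp0 hp1 ha0 ha1 s t
    rw [← hf] at hcr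
    have hnt := hne t ht
    rw [slope_def_field, div_sub_div _ _ hs hnt, div_div, div_eq_div_iff (by positivity) (by positivity)]
    rw [mul_comm (f (p * s)) (f t), hcr]
    ring
  have hdc : ContinuousOn (fun s => f s / f (p * s)) (Set.Icc x y) := fun t ht =>
    (hd t ht).continuousAt.continuousWithinAt
  have := (convex_Icc x y).image_sub_le_mul_sub_of_deriv_le hdc
    (fun t ht => (hd t (interior_subset ht)).differentiableAt.differentiableWithinAt) (C := -p)
    (fun t ht => ?_) x (Set.left_mem_Icc.2 hxy) y (Set.right_mem_Icc.2 hxy) hxy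
  · linarith
  · have ht' := interior_subset ht
    rw [(hd t ht').deriv]
    -- The n = 0 term of the kernel alone is f(pt)², whence the slope -p.
    have h0 := le_qBesselKernel_self hp0 hp1 ha0 ha1 t 0
    have h1 : 0 < f (p * t) * f (p * t) := by
      exact mul_self_pos.2 (hne t ht')
    rw [div_le_iff₀ h1]
    simp only [pow_zero, one_mul, zero_add, pow_one, ← hf] at h0
    nlinarith

end

/-! ### Existence and separation of the positive zeros. -/

lemma mul_pos_of_forall_Icc_ne_zero {f : ℝ → ℝ} (hf : Continuous f) {x y : ℝ} (hxy : x ≤ y)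
    (h : ∀ t ∈ Set.Icc x y, f t ≠ 0) : 0 < f x * f y := by
  have hx := h x (Set.left_mem_Icc.2 hxy)
  have hy := h y (Set.right_mem_Icc.2 hxy)
  by_contra hcon
  rcases lt_or_gt_of_ne hx with h1 | h1
  · have h2 : 0 ≤ f y := by
      by_contra h3
      exact hcon (mul_pos_of_neg_of_neg h1 (not_le.1 h3))
    obtain ⟨t, ht, ht0⟩ := intermediate_value_Icc hxy hf.continuousOn ⟨h1.le, h2⟩
    exact h t ht ht0
  · have h2 : f y ≤ 0 := by
      by_contra h3
      exact hcon (mul_pos h1 (not_le.1 h3))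
    obtain ⟨t, ht, ht0⟩ := intermediate_value_Icc' hxy hf.continuousOn ⟨h2, h1.le⟩
    exact h t ht ht0

/-- The positive zeros of `qBesselSeries a p` in increasing order, preceded by `0`. -/
noncomputable def qBesselSeriesZero (a p : ℝ) : ℕ → ℝ
  | 0 => 0
  | k + 1 => sInf {x : ℝ | qBesselSeriesZero a p k < x ∧ qBesselSeries a p x = 0}

section

variable {a p : ℝ}

/-- Setting y = w in the cross identity leaves f(x) f(pw) = -p (x - w) K(x, w), and K(w, w) > 0. -/
lemma eventually_mul_neg_of_qBesselSeries_eq_zero (hp0 : 0 < p) (hp1 : p < 1) (ha0 : 0 < a)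
    (ha1 : a < 1) {w : ℝ} (hw : qBesselSeries a p w = 0) :
    ∀ᶠ x in 𝓝[>] w, qBesselSeries a p x * qBesselSeries a p (p * w) < 0 := by
  have h1 : ∀ᶠ x in 𝓝[>] w, 0 < qBesselKernel a p x w :=
    nhdsWithin_le_nhds ((continuous_qBesselKernel hp0 hp1 ha0 ha1 w).continuousAt.eventually
      (lt_mem_nhds (qBesselKernel_self_pos hp0 hp1 ha0 ha1 w)))
  filter_upwards [h1, self_mem_nhdsWithin] with x hx hxw
  have h := qBesselSeries_cross_sub hp0 hp1 ha0 ha1 x w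
  rw [hw, zero_mul, sub_zero] at h
  rw [h]
  have hxw' : w < x := hxw
  have : 0 < p * (x - w) * qBesselKernel a p x w :=
    mul_pos (mul_pos hp0 (sub_pos.2 hxw')) hx
  linarith

lemma qBesselSeries_mul_ne_zero (hp0 : 0 < p) (hp1 : p < 1) (ha0 : 0 < a)
    (ha1 : a < 1) {w : ℝ} (hw : qBesselSeries a p w = 0) : qBesselSeries a p (p * w) ≠ 0 := by
  obtain ⟨x, hx⟩ := (eventually_mul_neg_of_qBesselSeries_eq_zero hp0 hp1 ha0 ha1 hw).exists
  exact right_ne_zero_of_mul hx.ne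

lemma qBesselSeries_div (hp0 : 0 < p) (hp1 : p < 1) (ha1 : a < 1) {w : ℝ}
    (hw : qBesselSeries a p w = 0) :
    qBesselSeries a p (w / p) = -(a / p) * qBesselSeries a p (p * w) := by
  have h := qBesselSeries_recurrence hp0 hp1 ha1 (w / p)
  rw [mul_div_cancel₀ w hp0.ne', hw] at h
  linarith

/-- Without further zeros the quotient f(x)/f(px) would stay positive forever, yet it falls with
slope at most -p. -/
lemma exists_zero_gt_of_mul_pos (hp0 : 0 < p) (hp1 : p < 1) (ha0 : 0 < a) (ha1 : a < 1) {x : ℝ}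
    (hx0 : 0 < x) (hx : 0 < qBesselSeries a p x * qBesselSeries a p (p * x)) :
    ∃ z, p * x < z ∧ qBesselSeries a p z = 0 := by
  by_contra! hcon
  have hc := continuous_qBesselSeries hp0 hp1 ha1
  set f := qBesselSeries a p with hf
  have hne : ∀ z, p * x ≤ z → f z ≠ 0 := fun z hz => by
    rcases hz.eq_or_lt with h | h
    · exact h ▸ right_ne_zero_of_mul hx.ne'
    · exact hcon z h
  set r := f x / f (p * x) with hr
  have hr0 : 0 < r := by rw [hr, ← mul_div_mul_right _ _ (right_ne_zero_of_mul hx.ne')]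
                         exact div_pos hx (mul_self_pos.2 (right_ne_zero_of_mul hx.ne'))
  set y := x + (r + 1) / p with hy
  have hxy : x ≤ y := by rw [hy]; have : 0 < (r + 1) / p := by positivity
                         linarith
  have h1 := qBesselSeries_ratio_le hp0 hp1 ha0 ha1 hxy
    fun t ht => hne _ (mul_le_mul_of_nonneg_left ht.1 hp0.le)
  have h2 : p * (y - x) = r + 1 := by rw [hy]; field_simp; ring
  have h3 : 0 < f (p * y) * f y := mul_pos_of_forall_Icc_ne_zero hc
    (by nlinarith) fun t ht => hne t ((mul_le_mul_of_nonneg_left hxy hp0.le).trans ht.1)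
  have h4 : 0 < f y / f (p * y) := by
    rw [← mul_div_mul_right _ _ (left_ne_zero_of_mul h3.ne'), mul_comm (f y)]
    exact div_pos h3 (mul_self_pos.2 (left_ne_zero_of_mul h3.ne'))
  rw [← hf, ← hr, h2] at h1
  linarith

/-- Just to the right of w, and also near w/p by `qBesselSeries_div`, f has the sign opposite to
f(pw). So f(x) and f(px) agree in sign for x slightly above w/p. -/
lemma exists_zero_gt_of_zero (hp0 : 0 < p) (hp1 : p < 1) (ha0 : 0 < a) (ha1 : a < 1) {w : ℝ}
    (hw0 : 0 < w) (hw : qBesselSeries a p w = 0) : ∃ z, w < z ∧ qBesselSeries a p z = 0 := by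
  have hc := continuous_qBesselSeries hp0 hp1 ha1
  have hne := qBesselSeries_mul_ne_zero hp0 hp1 ha0 ha1 hw
  have hdiv := qBesselSeries_div hp0 hp1 ha1 hw
  have hb : 0 < a / p := by positivity
  have h1 := eventually_mul_neg_of_qBesselSeries_eq_zero hp0 hp1 ha0 ha1 hw
  set f := qBesselSeries a p with hf
  have ht : Tendsto (fun x => p * x) (𝓝[>] (w / p)) (𝓝[>] w) := by
    refine tendsto_nhdsWithin_iff.2 ⟨?_, ?_⟩
    · have : Tendsto (fun x => p * x) (𝓝 (w / p)) (𝓝 (p * (w / p))) :=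
        (continuous_const_mul p).tendsto _
      rw [mul_div_cancel₀ w hp0.ne'] at this
      exact this.mono_left nhdsWithin_le_nhds
    · filter_upwards [self_mem_nhdsWithin] with x hx
      have : w / p < x := hx
      rw [div_lt_iff₀ hp0] at this
      rw [Set.mem_Ioi]
      linarith
  have h2 : ∀ᶠ x in 𝓝[>] (w / p), f x * f (p * w) < 0 := by
    refine nhdsWithin_le_nhds ((hc.mul continuous_const).continuousAt.eventually (gt_mem_nhds ?_))
    show f (w / p) * f (p * w) < 0
    rw [hdiv]
    have := mul_self_pos.2 hne
    nlinarith
  obtain ⟨x, ⟨hx1, hx2⟩, hx3⟩ := ((ht.eventually h1).and h2).and self_mem_nhdsWithin |>.exists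
  have hx3' : w / p < x := hx3
  have hx4 : w < p * x := by rw [div_lt_iff₀ hp0] at hx3'; linarith
  have hx5 : 0 < x := by have : 0 < w / p := by positivity
                         linarith
  have hx6 : 0 < f x * f (p * x) := by
    have := mul_pos_of_neg_of_neg hx1 hx2
    have h3 := mul_self_pos.2 hne
    rw [show f (p * x) * f (p * w) * (f x * f (p * w)) = (f x * f (p * x)) * (f (p * w) * f (p * w))
      by ring] at this
    exact pos_of_mul_pos_left this h3.le
  obtain ⟨z, hz, hz0⟩ := exists_zero_gt_of_mul_pos hp0 hp1 ha0 ha1 hx5 hx6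
  exact ⟨z, hx4.trans hz, hz0⟩

/-- The zero-free gap below η makes the set closed, so the infimum in the recursive definition is
attained. -/
lemma isLeast_sInf_zeros {f : ℝ → ℝ} (hf : Continuous f) {w η : ℝ} (hwη : w < η)
    (hne : ∀ z, w < z → f z = 0 → η ≤ z) (hex : ∃ z, w < z ∧ f z = 0) :
    IsLeast {x | w < x ∧ f x = 0} (sInf {x | w < x ∧ f x = 0}) := by
  have heq : {x | w < x ∧ f x = 0} = Set.Ici η ∩ f ⁻¹' {0} := by
    ext x
    exact ⟨fun h => ⟨hne x h.1 h.2, h.2⟩, fun h => ⟨hwη.trans_le h.1, h.2⟩⟩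
  have hbdd : BddBelow {x | w < x ∧ f x = 0} := ⟨w, fun x hx => hx.1.le⟩
  refine ⟨?_, fun x hx => csInf_le hbdd hx⟩
  have hcl : IsClosed {x | w < x ∧ f x = 0} := by
    rw [heq]
    exact isClosed_Ici.inter (isClosed_singleton.preimage hf)
  exact hcl.csInf_mem hex hbdd

/-- Consecutive zeros are separated by a factor larger than `1 / p`. -/
lemma qBesselSeriesZero_isLeast_and_lt (hp0 : 0 < p) (hp1 : p < 1) (ha0 : 0 < a) (ha1 : a < 1)
    (k : ℕ) :
    0 ≤ qBesselSeriesZero a p k ∧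
    IsLeast {x | qBesselSeriesZero a p k < x ∧ qBesselSeries a p x = 0}
      (qBesselSeriesZero a p (k + 1)) ∧
    qBesselSeriesZero a p k / p < qBesselSeriesZero a p (k + 1) := by
  have hc := continuous_qBesselSeries hp0 hp1 ha1
  induction k with
  | zero =>
    have h0 : ∀ᶠ x in 𝓝 0, 0 < qBesselSeries a p x :=
      hc.continuousAt.eventually (lt_mem_nhds (by rw [qBesselSeries_zero]; exact one_pos))
    obtain ⟨η, hη, hball⟩ := Metric.eventually_nhds_iff.1 h0
    have hpos : ∀ x, 0 ≤ x → x < η → 0 < qBesselSeries a p x := fun x hx hx' =>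
      hball (by rw [Real.dist_eq, sub_zero, abs_of_nonneg hx]; exact hx')
    have hl : IsLeast {x | qBesselSeriesZero a p 0 < x ∧ qBesselSeries a p x = 0}
        (qBesselSeriesZero a p 1) := by
      refine isLeast_sInf_zeros hc hη (fun z hz hz0 => ?_) ?_
      · by_contra! h
        exact (hpos z (le_of_lt hz) h).ne' hz0
      · obtain ⟨z, hz, hz0⟩ := exists_zero_gt_of_mul_pos hp0 hp1 ha0 ha1 (half_pos hη)
          (mul_pos (hpos _ (by positivity) (by linarith)) (hpos _ (by positivity) (by nlinarith)))
        exact ⟨z, lt_trans (by show (0 : ℝ) < _; positivity) hz, hz0⟩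
    refine ⟨le_rfl, hl, ?_⟩
    have : 0 < qBesselSeriesZero a p 1 := hl.1.1
    simpa [qBesselSeriesZero] using this
  | succ k ih =>
    obtain ⟨hk0, hl, hlt⟩ := ih
    set w := qBesselSeriesZero a p (k + 1) with hw
    have hw0 : 0 < w := hk0.trans_lt hl.1.1
    have hwz : qBesselSeries a p w = 0 := hl.1.2
    have hww : w < w / p := by rw [lt_div_iff₀ hp0]; nlinarith
    have hdiv : qBesselSeries a p (w / p) ≠ 0 := by
      rw [qBesselSeries_div hp0 hp1 ha1 hwz]
      exact mul_ne_zero (neg_ne_zero.2 (by positivity))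
        (qBesselSeries_mul_ne_zero hp0 hp1 ha0 ha1 hwz)
    have hge : ∀ z, w < z → qBesselSeries a p z = 0 → w / p ≤ z := by
      intro z hwz' hz0
      by_contra! hlt'
      -- The gap at the previous index keeps pt strictly between two consecutive zeros, so the
      -- quotient has no pole on [w, z]; vanishing at both ends contradicts its strict decrease.
      have := qBesselSeries_ratio_le hp0 hp1 ha0 ha1 hwz'.le fun t ht h0 => by
        have h1 : qBesselSeriesZero a p k < p * t := by
          rw [div_lt_iff₀ hp0] at hlt
          nlinarith [ht.1]
        have h2 := hl.2 ⟨h1, h0⟩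
        rw [lt_div_iff₀ hp0] at hlt'
        nlinarith [ht.2]
      rw [hwz, hz0, zero_div, zero_div, zero_sub] at this
      nlinarith
    have hl' : IsLeast {x | w < x ∧ qBesselSeries a p x = 0} (qBesselSeriesZero a p (k + 1 + 1)) :=
      isLeast_sInf_zeros hc hww hge (exists_zero_gt_of_zero hp0 hp1 ha0 ha1 hw0 hwz)
    refine ⟨hw0.le, hl', lt_of_le_of_ne (hge _ hl'.1.1 hl'.1.2) fun h => hdiv ?_⟩
    rw [h]
    exact hl'.1.2

lemma qBesselSeriesZero_isLeast (hp0 : 0 < p) (hp1 : p < 1) (ha0 : 0 < a) (ha1 : a < 1) (k : ℕ) :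
    IsLeast {x | qBesselSeriesZero a p k < x ∧ qBesselSeries a p x = 0}
      (qBesselSeriesZero a p (k + 1)) :=
  (qBesselSeriesZero_isLeast_and_lt hp0 hp1 ha0 ha1 k).2.1

lemma qBesselSeries_zero_succ (hp0 : 0 < p) (hp1 : p < 1) (ha0 : 0 < a) (ha1 : a < 1) (k : ℕ) :
    qBesselSeries a p (qBesselSeriesZero a p (k + 1)) = 0 :=
  (qBesselSeriesZero_isLeast hp0 hp1 ha0 ha1 k).1.2

lemma qBesselSeriesZero_succ_pos (hp0 : 0 < p) (hp1 : p < 1) (ha0 : 0 < a) (ha1 : a < 1) (k : ℕ) :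
    0 < qBesselSeriesZero a p (k + 1) :=
  (qBesselSeriesZero_isLeast_and_lt hp0 hp1 ha0 ha1 k).1.trans_lt
    (qBesselSeriesZero_isLeast hp0 hp1 ha0 ha1 k).1.1

lemma qBesselSeriesZero_lt_mul (hp0 : 0 < p) (hp1 : p < 1) (ha0 : 0 < a) (ha1 : a < 1) (k : ℕ) :
    qBesselSeriesZero a p k < p * qBesselSeriesZero a p (k + 1) := by
  have := (qBesselSeriesZero_isLeast_and_lt hp0 hp1 ha0 ha1 k).2.2
  rwa [div_lt_iff₀ hp0, mul_comm] at this

lemma qBesselSeries_ne_zero_of_between (hp0 : 0 < p) (hp1 : p < 1) (ha0 : 0 < a) (ha1 : a < 1)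
    {k : ℕ} {x : ℝ} (h1 : qBesselSeriesZero a p k < x) (h2 : x < qBesselSeriesZero a p (k + 1)) :
    qBesselSeries a p x ≠ 0 := fun h =>
  ((qBesselSeriesZero_isLeast hp0 hp1 ha0 ha1 k).2 ⟨h1, h⟩).not_gt h2

lemma qBesselSeries_mul_pos_of_between (hp0 : 0 < p) (hp1 : p < 1) (ha0 : 0 < a) (ha1 : a < 1)
    {k : ℕ} {x y : ℝ} (hx1 : qBesselSeriesZero a p k < x) (hx2 : x < qBesselSeriesZero a p (k + 1))
    (hy1 : qBesselSeriesZero a p k < y) (hy2 : y < qBesselSeriesZero a p (k + 1)) :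
    0 < qBesselSeries a p x * qBesselSeries a p y := by
  have hc := continuous_qBesselSeries hp0 hp1 ha1
  rcases le_total x y with h | h
  · exact mul_pos_of_forall_Icc_ne_zero hc h fun t ht =>
      qBesselSeries_ne_zero_of_between hp0 hp1 ha0 ha1 (hx1.trans_le ht.1) (ht.2.trans_lt hy2)
  · rw [mul_comm]
    exact mul_pos_of_forall_Icc_ne_zero hc h fun t ht =>
      qBesselSeries_ne_zero_of_between hp0 hp1 ha0 ha1 (hy1.trans_le ht.1) (ht.2.trans_lt hx2)

/-! ### Comparison of the parameters a and ap; lower bounds for p^k w_k. -/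

/-- By `qBesselSeries_sub`, the point pt is such a zero when t > 0 and f(t) = f(pt). On [w/p, w'],
for consecutive zeros w < w', the difference f(t) - f(pt) runs from f(w/p) to -f(pw'), which have
opposite signs. -/
lemma exists_zero_shift (hp0 : 0 < p) (hp1 : p < 1) (ha0 : 0 < a) (ha1 : a < 1) (k : ℕ) :
    ∃ z, qBesselSeriesZero a p (k + 1) < z ∧ z < p * qBesselSeriesZero a p (k + 2) ∧
      qBesselSeries (a * p) p z = 0 := by
  have hc := continuous_qBesselSeries hp0 hp1 ha1
  have hw0 := qBesselSeriesZero_succ_pos hp0 hp1 ha0 ha1 k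
  have hww := qBesselSeriesZero_lt_mul hp0 hp1 ha0 ha1 (k + 1)
  have hfw := qBesselSeries_zero_succ hp0 hp1 ha0 ha1 k
  have hfw' := qBesselSeries_zero_succ hp0 hp1 ha0 ha1 (k + 1)
  have hsgn := fun x y => qBesselSeries_mul_pos_of_between (x := x) (y := y) hp0 hp1 ha0 ha1
    (k := k + 1)
  set w := qBesselSeriesZero a p (k + 1)
  set w' := qBesselSeriesZero a p (k + 1 + 1)
  have h1 : w < w / p := by rw [lt_div_iff₀ hp0]; nlinarith
  have h2 : w / p < w' := by rw [div_lt_iff₀ hp0]; linarith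
  have h3 : p * w' < w' := by nlinarith
  have hneg := hsgn (w / p) (p * w') h1 h2 hww h3
  have hl : p * (w / p) = w := mul_div_cancel₀ w hp0.ne'
  obtain ⟨t, ht, ht0⟩ : ∃ t ∈ Set.Icc (w / p) w',
      qBesselSeries a p t - qBesselSeries a p (p * t) = 0 := by
    by_contra! hcon
    have := mul_pos_of_forall_Icc_ne_zero
      (f := fun t => qBesselSeries a p t - qBesselSeries a p (p * t)) (by fun_prop) h2.le hcon
    simp only [hl, hfw, hfw'] at this
    linarith
  have hg : qBesselSeries (a * p) p (p * t) = 0 := by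
    rw [qBesselSeries_sub hp0 hp1 ha1] at ht0
    have htpos : 0 < t := (hw0.trans h1).trans_le ht.1
    have : -(p / (1 - a)) * t ≠ 0 :=
      mul_ne_zero (neg_ne_zero.2 (div_pos hp0 (by linarith)).ne') htpos.ne'
    exact (mul_eq_zero.1 ht0).resolve_left this
  refine ⟨p * t, lt_of_le_of_ne ?_ ?_, lt_of_le_of_ne ?_ ?_, hg⟩
  · have := mul_le_mul_of_nonneg_left ht.1 hp0.le
    rwa [hl] at this
  · intro h
    have ht' : t = w / p := by rw [h]; field_simp
    rw [ht', hl, hfw, sub_zero] at ht0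
    rw [ht0, zero_mul] at hneg
    exact lt_irrefl _ hneg
  · exact mul_le_mul_of_nonneg_left ht.2 hp0.le
  · intro h
    have ht' : t = w' := mul_left_cancel₀ hp0.ne' h
    rw [ht', hfw', zero_sub, neg_eq_zero] at ht0
    rw [ht0, mul_zero] at hneg
    exact lt_irrefl _ hneg

lemma qBesselSeriesZero_shift_lt (hp0 : 0 < p) (hp1 : p < 1) (ha0 : 0 < a) (ha1 : a < 1) (k : ℕ) :
    qBesselSeriesZero (a * p) p (k + 1) < p * qBesselSeriesZero a p (k + 2) := by
  have hap0 : 0 < a * p := by positivity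
  have hap1 : a * p < 1 := by nlinarith
  induction k with
  | zero =>
    obtain ⟨z, hz1, hz2, hz0⟩ := exists_zero_shift hp0 hp1 ha0 ha1 0
    exact ((qBesselSeriesZero_isLeast hp0 hp1 hap0 hap1 0).2
      ⟨(qBesselSeriesZero_succ_pos hp0 hp1 ha0 ha1 0).trans hz1, hz0⟩).trans_lt hz2
  | succ k ih =>
    obtain ⟨z, hz1, hz2, hz0⟩ := exists_zero_shift hp0 hp1 ha0 ha1 (k + 1)
    have h1 := qBesselSeriesZero_succ_pos hp0 hp1 ha0 ha1 (k + 1)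
    have h2 : qBesselSeriesZero (a * p) p (k + 1) < z := by
      have : p * qBesselSeriesZero a p (k + 2) ≤ qBesselSeriesZero a p (k + 2) := by nlinarith
      exact (ih.trans_le this).trans hz1
    exact ((qBesselSeriesZero_isLeast hp0 hp1 hap0 hap1 (k + 1)).2 ⟨h2, hz0⟩).trans_lt hz2

lemma qBesselSeriesZero_shift_pow_le (hp0 : 0 < p) (hp1 : p < 1) (m : ℕ) :
    ∀ a : ℝ, 0 < a → a < 1 → ∀ k : ℕ,
      qBesselSeriesZero (a * p ^ m) p (k + 1) ≤ p ^ m * qBesselSeriesZero a p (k + m + 1) := by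
  induction m with
  | zero => intro a _ _ k; simp
  | succ m ih =>
    intro a ha0 ha1 k
    have h1 := ih (a * p) (by positivity) (by nlinarith) k
    have h2 := qBesselSeriesZero_shift_lt hp0 hp1 ha0 ha1 (k + m)
    rw [show a * p ^ (m + 1) = a * p * p ^ m by ring]
    calc _ ≤ _ := h1
      _ ≤ p ^ m * (p * qBesselSeriesZero a p (k + m + 2)) := by gcongr
      _ = _ := by rw [show k + (m + 1) + 1 = k + m + 2 by ring]; ring

/-- With r = (1 - pc)/2, the bound r f(px) ≤ f(x) propagates from px to x: the recurrence gives f(x)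
≥ 2r f(px) - r² f(p²x) ≥ r f(px). -/
lemma qBesselSeries_pos_of_small (hp0 : 0 < p) (hp1 : p < 1) (ha0 : 0 < a) (ha1 : a < 1) {c : ℝ}
    (hc0 : 0 ≤ c) (hc : p * c < 1) (hb : a / p ≤ ((1 - p * c) / 2) ^ 2) {x : ℝ} (hx0 : 0 ≤ x)
    (hxc : x ≤ c) : 0 < qBesselSeries a p x := by
  have hcont := continuous_qBesselSeries hp0 hp1 ha1
  have hrec := qBesselSeries_recurrence hp0 hp1 ha1
  have hlim := fun x => tendsto_qBesselSeries_pow_mul hp0 hp1 ha1 x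
  set f := qBesselSeries a p
  set r := (1 - p * c) / 2 with hr
  have hr0 : 0 < r := by rw [hr]; linarith
  have hr1 : r < 1 := by rw [hr]; nlinarith
  have hb0 : 0 < a / p := by positivity
  have step : ∀ x, 0 ≤ x → x ≤ c → 0 < f (p * (p * x)) ∧ r * f (p * (p * x)) ≤ f (p * x) →
      0 < f (p * x) ∧ r * f (p * x) ≤ f x := by
    rintro x hx hxc ⟨h1, h2⟩
    have h3 : 0 < f (p * x) := (mul_pos hr0 h1).trans_le h2
    refine ⟨h3, ?_⟩
    rw [hrec x]
    have h4 : a / p * f (p * (p * x)) ≤ r * f (p * x) := by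
      calc _ ≤ r ^ 2 * f (p * (p * x)) := by gcongr
        _ = r * (r * f (p * (p * x))) := by ring
        _ ≤ _ := by gcongr
    have h5 : 2 * r ≤ 1 + a / p - p * x := by
      have : p * x ≤ p * c := by gcongr
      rw [hr]; linarith
    nlinarith
  -- Near 0 the function is close to 1 and r < 1, so the invariant holds at a small enough scale.
  have hev : ∃ N : ℕ, 0 < f (p * (p ^ N * x)) ∧ r * f (p * (p ^ N * x)) ≤ f (p ^ N * x) := by
    have h1 := (hlim x).comp (tendsto_add_atTop_nat 1)
    have h2 := ((hlim x).sub (h1.const_mul r)).eventually (lt_mem_nhds (show 0 < 1 - r * 1 by linarith))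
    have h3 := h1.eventually (lt_mem_nhds zero_lt_one)
    obtain ⟨N, hN, hN'⟩ := (h2.and h3).exists
    simp only [Function.comp, pow_succ', mul_assoc] at hN hN'
    exact ⟨N, hN', by linarith⟩
  obtain ⟨N, hN⟩ := hev
  have hall : 0 < f (p * x) ∧ r * f (p * x) ≤ f x := by
    induction N with
    | zero => simpa using hN
    | succ N ih =>
      refine ih (step _ (by positivity) ?_ (by simpa only [pow_succ', mul_assoc] using hN))
      have : p ^ N ≤ 1 := pow_le_one₀ hp0.le hp1.le
      nlinarith
  exact (mul_pos hr0 hall.1).trans_le hall.2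

/-- Applying m parameter shifts bounds p^m w_{m+1} below by the first zero for a p^m. That zero
exceeds d/p once a p^m is small, by positivity on [0, d/p]. -/
lemma eventually_lt_pow_mul_qBesselSeriesZero (hp0 : 0 < p) (hp1 : p < 1) (ha0 : 0 < a)
    (ha1 : a < 1) {d : ℝ} (hd0 : 0 ≤ d) (hd : d < 1) :
    ∀ᶠ k : ℕ in atTop, d < p ^ k * qBesselSeriesZero a p k := by
  have hlim : Tendsto (fun m : ℕ => a * p ^ m / p) atTop (𝓝 0) := by
    simpa using ((tendsto_pow_atTop_nhds_zero_of_lt_one hp0.le hp1).const_mul a).div_const p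
  have hr : 0 < ((1 - p * (d / p)) / 2) ^ 2 := by
    rw [mul_div_cancel₀ _ hp0.ne']
    have : 0 < 1 - d := by linarith
    positivity
  rw [← map_add_atTop_eq_nat 1, eventually_map]
  filter_upwards [hlim.eventually (gt_mem_nhds hr)] with m hm
  have hm0 : 0 < a * p ^ m := by positivity
  have hm1 : a * p ^ m < 1 := by
    have : p ^ m ≤ 1 := pow_le_one₀ hp0.le hp1.le
    nlinarith
  have h1 : d / p < qBesselSeriesZero (a * p ^ m) p 1 := by
    by_contra! hle
    have := qBesselSeries_pos_of_small hp0 hp1 hm0 hm1 (c := d / p) (by positivity)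
      (by rwa [mul_div_cancel₀ _ hp0.ne']) hm.le
      (qBesselSeriesZero_succ_pos hp0 hp1 hm0 hm1 0).le hle
    exact this.ne' (qBesselSeries_zero_succ hp0 hp1 hm0 hm1 0)
  have h2 := qBesselSeriesZero_shift_pow_le hp0 hp1 m a ha0 ha1 0
  rw [zero_add, zero_add] at h2
  rw [div_lt_iff₀ hp0] at h1
  rw [pow_succ]
  nlinarith

/-! ### Gap estimate and the sharp lower bound. -/

/-- For consecutive zeros w < w', the quotient f(x)/f(px) is 0 at w, and the recurrence at w' gives
its value at pw'. The slope bound on [w, pw'] compares the two. -/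
lemma qBesselSeriesZero_gap_le (hp0 : 0 < p) (hp1 : p < 1) (ha0 : 0 < a) (ha1 : a < 1) {k : ℕ}
    (hk : 1 + a / p < p * qBesselSeriesZero a p (k + 2)) :
    p * (p * qBesselSeriesZero a p (k + 2) - qBesselSeriesZero a p (k + 1)) ≤
      a / p / (p * qBesselSeriesZero a p (k + 2) - 1 - a / p) := by
  have hw0 := qBesselSeriesZero_succ_pos hp0 hp1 ha0 ha1 k
  have hww := qBesselSeriesZero_lt_mul hp0 hp1 ha0 ha1 (k + 1)
  have hvw := qBesselSeriesZero_lt_mul hp0 hp1 ha0 ha1 k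
  have hfw := qBesselSeries_zero_succ hp0 hp1 ha0 ha1 k
  have hrec := qBesselSeries_recurrence hp0 hp1 ha1 (qBesselSeriesZero a p (k + 2))
  rw [qBesselSeries_zero_succ hp0 hp1 ha0 ha1 (k + 1)] at hrec
  have hsgn := fun x y => qBesselSeries_mul_pos_of_between (x := x) (y := y) hp0 hp1 ha0 ha1
    (k := k + 1)
  have hne := fun x => qBesselSeries_ne_zero_of_between (x := x) hp0 hp1 ha0 ha1 (k := k)
  have hne' := fun x => qBesselSeries_ne_zero_of_between (x := x) hp0 hp1 ha0 ha1 (k := k + 1)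
  change qBesselSeriesZero a p (k + 1) < p * qBesselSeriesZero a p (k + 2) at hww
  change ∀ x y, _ → x < qBesselSeriesZero a p (k + 2) → _ → y < qBesselSeriesZero a p (k + 2) → _
    at hsgn
  change ∀ x, _ → x < qBesselSeriesZero a p (k + 2) → _ at hne'
  have hb0 : 0 < a / p := by positivity
  have hratio := qBesselSeries_ratio_le hp0 hp1 ha0 ha1 hww.le
  set w := qBesselSeriesZero a p (k + 1)
  set w' := qBesselSeriesZero a p (k + 2)
  set f := qBesselSeries a p
  set b := a / p
  have hw'0 : 0 < w' := pos_of_mul_pos_right (hw0.trans hww) hp0.le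
  have hpw' : p * w' < w' := by nlinarith
  have hppw' : p * (p * w') < p * w' := by nlinarith
  have hf1 : f (p * w') ≠ 0 := hne' _ hww hpw'
  -- This excludes poles on [w, pw']. Otherwise f(p²w') would vanish or share the sign of f(pw'),
  -- while the recurrence with pw' > 1 + b makes them nonzero of opposite signs.
  have h1 : p * (p * w') < w := by
    by_contra! hle
    rcases hle.eq_or_lt with h | h
    · rw [← h, hfw, mul_zero, sub_zero] at hrec
      exact hf1 ((mul_eq_zero.1 hrec.symm).resolve_left (by linarith))
    · have h2 := hsgn _ _ h (hppw'.trans hpw') hww hpw'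
      have h3 : b * (f (p * (p * w')) * f (p * w')) = (1 + b - p * w') * (f (p * w')) ^ 2 := by
        linear_combination (f (p * w')) * hrec
      have h4 : 0 < (f (p * w')) ^ 2 := by positivity
      nlinarith
  have hf2 : f (p * (p * w')) ≠ 0 := by
    refine hne _ (hvw.trans ?_) h1
    gcongr
  have h2 := hratio fun t ht => by
    refine hne _ (hvw.trans_le (mul_le_mul_of_nonneg_left ht.1 hp0.le))
      ((mul_le_mul_of_nonneg_left ht.2 hp0.le).trans_lt h1)
  have h3 : f (p * w') / f (p * (p * w')) = -(b / (p * w' - 1 - b)) := by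
    have : p * w' - 1 - b ≠ 0 := by linarith
    rw [← neg_div, div_eq_div_iff hf2 this]
    linear_combination hrec
  rw [h3, hfw, zero_div] at h2
  linarith

lemma eventually_pow_mul_qBesselSeriesZero_succ_le (hp0 : 0 < p) (hp1 : p < 1) (ha0 : 0 < a)
    (ha1 : a < 1) : ∀ᶠ k : ℕ in atTop, p ^ (k + 1) * qBesselSeriesZero a p (k + 1) ≤
      p ^ k * qBesselSeriesZero a p k + 4 * (a / p) / p * (p ^ k) ^ 2 := by
  have hhalf := eventually_lt_pow_mul_qBesselSeriesZero hp0 hp1 ha0 ha1 (d := 1 / 2)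
    (by norm_num) (by norm_num)
  rw [← map_add_atTop_eq_nat 2, eventually_map] at hhalf
  have hlim : Tendsto (fun k : ℕ => (1 + a / p) * p ^ (k + 1)) atTop (𝓝 0) := by
    simpa using ((tendsto_pow_atTop_nhds_zero_of_lt_one hp0.le hp1).comp
      (tendsto_add_atTop_nat 1)).const_mul (1 + a / p)
  rw [← map_add_atTop_eq_nat 1, eventually_map]
  filter_upwards [hhalf, hlim.eventually (gt_mem_nhds (show (0 : ℝ) < 1 / 4 by norm_num))] with k h1 h2
  have hb0 : 0 < a / p := by positivity
  have hP : 0 < p ^ (k + 1) := by positivity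
  have hgap := qBesselSeriesZero_gap_le hp0 hp1 ha0 ha1 (k := k)
  change _ ≤ p ^ (k + 1) * qBesselSeriesZero a p (k + 1) + _
  change p ^ (k + 2) * qBesselSeriesZero a p (k + 2) ≤ _
  rw [show p ^ (k + 2) = p ^ (k + 1) * p by ring] at h1 ⊢
  set P := p ^ (k + 1)
  set w := qBesselSeriesZero a p (k + 1)
  set w' := qBesselSeriesZero a p (k + 2)
  set b := a / p
  -- Eventually P p w' > 1/2 and (1 + b) P < 1/4; this is the origin of the factor 4.
  have h3 : 1 / 4 < P * (p * w' - 1 - b) := by nlinarith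
  have h4 : 0 < p * w' - 1 - b := by
    refine pos_of_mul_pos_right ?_ hP.le
    linarith
  have h5 : b / (p * w' - 1 - b) ≤ 4 * b * P := by
    rw [div_le_iff₀ h4]
    nlinarith
  have h6 : p * w' - w ≤ 4 * b / p * P := by
    rw [div_mul_eq_mul_div, le_div_iff₀ hp0]
    linarith [hgap (by linarith)]
  nlinarith

lemma eventually_one_sub_lt_pow_mul_qBesselSeriesZero (hp0 : 0 < p) (hp1 : p < 1) (ha0 : 0 < a)
    (ha1 : a < 1) :
    ∀ᶠ k : ℕ in atTop, 1 - a * p ^ k < p ^ k * qBesselSeriesZero a p k := by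
  set u : ℕ → ℝ := fun k => p ^ k * qBesselSeriesZero a p k with hu
  set C := 4 * (a / p) / p with hC
  have hC0 : 0 < C := by positivity
  have hp2 : 0 < 1 - p ^ 2 := by nlinarith
  have hlim : Tendsto (fun k : ℕ => C / (1 - p ^ 2) * p ^ k) atTop (𝓝 0) := by
    simpa using (tendsto_pow_atTop_nhds_zero_of_lt_one hp0.le hp1).const_mul (C / (1 - p ^ 2))
  obtain ⟨K, hK⟩ := eventually_atTop.1 (eventually_pow_mul_qBesselSeriesZero_succ_le hp0 hp1 ha0 ha1)
  -- The increments C p^(2k) telescope as C/(1 - p²) (p^(2k) - p^(2k+2)).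
  have hsum : ∀ k, K ≤ k → ∀ n, u (k + n) ≤
      u k + C / (1 - p ^ 2) * ((p ^ k) ^ 2 - (p ^ (k + n)) ^ 2) := by
    intro k hk n
    induction n with
    | zero => simp
    | succ n ih =>
      have h1 : u (k + n + 1) ≤ u (k + n) + C * (p ^ (k + n)) ^ 2 := hK (k + n) (by omega)
      have h2 : C / (1 - p ^ 2) * (1 - p ^ 2) = C := by field_simp
      rw [← add_assoc, pow_succ p (k + n)]
      calc _ ≤ _ := h1
        _ ≤ u k + C / (1 - p ^ 2) * ((p ^ k) ^ 2 - (p ^ (k + n)) ^ 2) +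
            C / (1 - p ^ 2) * (1 - p ^ 2) * (p ^ (k + n)) ^ 2 := by rw [h2]; gcongr
        _ = _ := by ring
  filter_upwards [eventually_ge_atTop K, hlim.eventually (gt_mem_nhds ha0)] with k hk hka
  have hP : 0 < p ^ k := by positivity
  -- Letting n tend to infinity in `hsum`: the left side eventually exceeds each d < 1.
  have hle : 1 ≤ u k + C / (1 - p ^ 2) * (p ^ k) ^ 2 := by
    refine le_of_forall_lt fun d hd => ?_
    have hd' := eventually_lt_pow_mul_qBesselSeriesZero hp0 hp1 ha0 ha1 (d := max d 0)
      (le_max_right _ _) (max_lt hd one_pos)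
    obtain ⟨N, hN⟩ := eventually_atTop.1 hd'
    have h1 : max d 0 < u (k + N) := hN (k + N) (by omega)
    have h2 := hsum k hk N
    have h3 : 0 ≤ C / (1 - p ^ 2) * (p ^ (k + N)) ^ 2 := by positivity
    linarith [le_max_left d 0]
  nlinarith

end

/-! ### Transfer to the Hahn-Exton function. -/

lemma qShiftedFactorialInf_ne_zero {a p : ℝ} (hp0 : 0 < p) (hp1 : p < 1) (ha1 : a < 1) :
    qShiftedFactorialInf a p ≠ 0 := by
  unfold qShiftedFactorialInf
  simp only [sub_eq_add_neg]
  refine tprod_one_add_ne_zero_of_summable (f := fun i : ℕ => -(a * p ^ i)) (fun i => ?_) ?_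
  · have := one_sub_mul_pow_pos hp0 hp1 ha1 i
    linarith
  · exact ((summable_geometric_of_lt_one hp0.le hp1).mul_left a).neg.norm

lemma hahnExtonBessel_eq_zero_iff {ν p z : ℝ} (hp0 : 0 < p) (hp1 : p < 1) (hν : -1 < ν)
    (hz : 0 < z) :
    hahnExtonBessel ν p z = 0 ↔ qBesselSeries (p ^ (ν + 1)) p (z ^ 2) = 0 := by
  have ha1 : p ^ (ν + 1) < 1 := Real.rpow_lt_one hp0.le hp1 (by linarith)
  have h1 : z ^ ν * (qShiftedFactorialInf (p ^ (ν + 1)) p / qShiftedFactorialInf p p) ≠ 0 :=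
    mul_ne_zero (Real.rpow_pos_of_pos hz ν).ne' (div_ne_zero
      (qShiftedFactorialInf_ne_zero hp0 hp1 ha1) (qShiftedFactorialInf_ne_zero hp0 hp1 hp1))
  unfold hahnExtonBessel qBesselSeries qBesselCoeff
  simp only [mul_eq_zero, h1, false_or, pow_mul]

lemma besselZero_eq_sqrt {q ν : ℝ} (hq0 : 0 < q) (hq1 : q < 1) (hν : -1 < ν) (k : ℕ) :
    besselZero ν q k = √(qBesselSeriesZero ((q ^ 2) ^ (ν + 1)) (q ^ 2) k) := by
  have hp0 : 0 < q ^ 2 := by positivity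
  have hp1 : q ^ 2 < 1 := by nlinarith
  have ha0 : 0 < (q ^ 2) ^ (ν + 1) := Real.rpow_pos_of_pos hp0 _
  have ha1 : (q ^ 2) ^ (ν + 1) < 1 := Real.rpow_lt_one hp0.le hp1 (by linarith)
  induction k with
  | zero => simp [besselZero, qBesselSeriesZero]
  | succ k ih =>
    have hl := qBesselSeriesZero_isLeast hp0 hp1 ha0 ha1 k
    have hk0 := (qBesselSeriesZero_isLeast_and_lt hp0 hp1 ha0 ha1 k).1
    have hs0 := qBesselSeriesZero_succ_pos hp0 hp1 ha0 ha1 k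
    have hleast : IsLeast {z | besselZero ν q k < z ∧ hahnExtonBessel ν (q ^ 2) z = 0}
        (√(qBesselSeriesZero ((q ^ 2) ^ (ν + 1)) (q ^ 2) (k + 1))) := by
      refine ⟨⟨?_, ?_⟩, ?_⟩
      · rw [ih]
        exact Real.sqrt_lt_sqrt hk0 hl.1.1
      · rw [hahnExtonBessel_eq_zero_iff hp0 hp1 hν (Real.sqrt_pos.2 hs0), Real.sq_sqrt hs0.le]
        exact hl.1.2
      · rintro z ⟨hz, hz0⟩
        rw [ih] at hz
        have hzpos : 0 < z := (Real.sqrt_nonneg _).trans_lt hz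
        rw [hahnExtonBessel_eq_zero_iff hp0 hp1 hν hzpos] at hz0
        rw [Real.sqrt_le_left hzpos.le]
        exact hl.2 ⟨(Real.sqrt_lt' hzpos).1 hz, hz0⟩
    exact hleast.csInf_eq

lemma besselZero_succ_pos {q ν : ℝ} (hq0 : 0 < q) (hq1 : q < 1) (hν : -1 < ν) (k : ℕ) :
    0 < besselZero ν q (k + 1) := by
  have hp0 : 0 < q ^ 2 := by positivity
  rw [besselZero_eq_sqrt hq0 hq1 hν, Real.sqrt_pos]
  exact qBesselSeriesZero_succ_pos hp0 (by nlinarith) (Real.rpow_pos_of_pos hp0 _)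
    (Real.rpow_lt_one hp0.le (by nlinarith) (by linarith)) k

lemma besselZero_div_lt {q ν : ℝ} (hq0 : 0 < q) (hq1 : q < 1) (hν : -1 < ν) (k : ℕ) :
    besselZero ν q k / q < besselZero ν q (k + 1) := by
  have hp0 : 0 < q ^ 2 := by positivity
  have hp1 : q ^ 2 < 1 := by nlinarith
  have ha0 : 0 < (q ^ 2) ^ (ν + 1) := Real.rpow_pos_of_pos hp0 _
  have ha1 : (q ^ 2) ^ (ν + 1) < 1 := Real.rpow_lt_one hp0.le hp1 (by linarith)
  have h := qBesselSeriesZero_lt_mul hp0 hp1 ha0 ha1 k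
  have h0 := (qBesselSeriesZero_isLeast_and_lt hp0 hp1 ha0 ha1 k).1
  have h1 := Real.sqrt_lt_sqrt h0 h
  rw [Real.sqrt_mul hp0.le, Real.sqrt_sq hq0.le, ← besselZero_eq_sqrt hq0 hq1 hν,
    ← besselZero_eq_sqrt hq0 hq1 hν] at h1
  rw [div_lt_iff₀ hq0]
  linarith

lemma besselZero_eq_rpow {q ν : ℝ} (hq0 : 0 < q) (hq1 : q < 1) (hν : -1 < ν) (k : ℕ) :
    besselZero ν q (k + 1) = q ^ (-((k + 1 : ℕ) : ℝ) + besselZeroEps ν q (k + 1)) := by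
  rw [besselZeroEps, neg_add_cancel_left,
    Real.rpow_logb hq0 hq1.ne (besselZero_succ_pos hq0 hq1 hν k)]

lemma besselZeroEps_succ_lt {q ν : ℝ} (hq0 : 0 < q) (hq1 : q < 1) (hν : -1 < ν) (k : ℕ) :
    besselZeroEps ν q (k + 2) < besselZeroEps ν q (k + 1) := by
  have h0 := besselZero_succ_pos hq0 hq1 hν k
  have h1 := Real.logb_lt_logb_of_base_lt_one hq0 hq1 (div_pos h0 hq0)
    (besselZero_div_lt hq0 hq1 hν (k + 1))
  rw [Real.logb_div h0.ne' hq0.ne', Real.logb_self_eq_one_iff.2 ⟨hq0.ne', hq1.ne, by linarith⟩] at h1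
  unfold besselZeroEps
  push_cast
  change Real.logb q (besselZero ν q (k + 2)) < _ at h1
  linarith

lemma rpow_besselAlpha_sq {q ν : ℝ} (hq0 : 0 < q) (hq1 : q < 1) {k : ℕ}
    (hpos : 0 < 1 - q ^ (2 * ((k : ℝ) + ν)) / (1 - q ^ (2 * k))) :
    (q ^ besselAlpha ν q k) ^ 2 = 1 - q ^ (2 * ((k : ℝ) + ν)) / (1 - q ^ (2 * k)) := by
  have hlog : Real.log q ≠ 0 := (Real.log_neg hq0 hq1).ne
  rw [Real.rpow_def_of_pos hq0, ← Real.exp_nat_mul, besselAlpha]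
  rw [show ((2 : ℕ) : ℝ) * (Real.log q * (Real.log (1 - q ^ (2 * ((k : ℝ) + ν)) / (1 - q ^ (2 * k))) /
    (2 * Real.log q))) = Real.log (1 - q ^ (2 * ((k : ℝ) + ν)) / (1 - q ^ (2 * k))) by
      push_cast; field_simp]
  exact Real.exp_log hpos

lemma eventually_rpow_lt_besselZero_div {q ν : ℝ} (hq0 : 0 < q) (hq1 : q < 1) (hν : -1 < ν) :
    ∀ᶠ k : ℕ in atTop,
      q ^ (-(k : ℝ) - 1 + besselAlpha ν q (k + 1)) < besselZero ν q k / q := by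
  have hp0 : 0 < q ^ 2 := by positivity
  have hp1 : q ^ 2 < 1 := by nlinarith
  have ha0 : 0 < (q ^ 2) ^ (ν + 1) := Real.rpow_pos_of_pos hp0 _
  have ha1 : (q ^ 2) ^ (ν + 1) < 1 := Real.rpow_lt_one hp0.le hp1 (by linarith)
  have hlim : Tendsto (fun k : ℕ => (q ^ 2) ^ (ν + 1) * (q ^ 2) ^ k) atTop (𝓝 0) := by
    simpa using (tendsto_pow_atTop_nhds_zero_of_lt_one hp0.le hp1).const_mul ((q ^ 2) ^ (ν + 1))
  filter_upwards [eventually_one_sub_lt_pow_mul_qBesselSeriesZero hp0 hp1 ha0 ha1,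
    hlim.eventually (gt_mem_nhds (show 0 < 1 - q ^ 2 by linarith))] with k hk hsmall
  have hW0 := (qBesselSeriesZero_isLeast_and_lt hp0 hp1 ha0 ha1 k).1
  have hnum : q ^ (2 * (((k + 1 : ℕ) : ℝ) + ν)) = (q ^ 2) ^ (ν + 1) * (q ^ 2) ^ k := by
    rw [← Real.rpow_natCast (q ^ 2) k, ← Real.rpow_add hp0, ← Real.rpow_natCast q 2,
      ← Real.rpow_mul hq0.le]
    congr 1
    push_cast
    ring
  have hden : q ^ 2 * (q ^ 2) ^ k = q ^ (2 * (k + 1)) := by rw [← pow_succ', ← pow_mul]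
  have hden0 : 0 < q ^ (2 * (k + 1)) := by positivity
  have hden1 : q ^ (2 * (k + 1)) ≤ q ^ 2 := by
    rw [← hden]
    have : (q ^ 2) ^ k ≤ 1 := pow_le_one₀ hp0.le hp1.le
    nlinarith
  have hδ0 : 0 < (q ^ 2) ^ (ν + 1) * (q ^ 2) ^ k := by positivity
  have hpos : 0 < 1 - q ^ (2 * (((k + 1 : ℕ) : ℝ) + ν)) / (1 - q ^ (2 * (k + 1))) := by
    rw [hnum, sub_pos, div_lt_one (by linarith)]
    linarith
  have hsq := rpow_besselAlpha_sq hq0 hq1 hpos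
  rw [hnum] at hsq
  -- The denominator in α_{k+1} only lowers the bound, so u_k > 1 - a p^k is more than enough.
  have hle : (q ^ 2) ^ (ν + 1) * (q ^ 2) ^ k ≤
      (q ^ 2) ^ (ν + 1) * (q ^ 2) ^ k / (1 - q ^ (2 * (k + 1))) :=
    le_div_self hδ0.le (by linarith) (by linarith)
  have hlt : q ^ besselAlpha ν q (k + 1) < q ^ k * besselZero ν q k := by
    refine lt_of_pow_lt_pow_left₀ 2 (by rw [besselZero_eq_sqrt hq0 hq1 hν]; positivity) ?_
    rw [hsq, mul_pow, besselZero_eq_sqrt hq0 hq1 hν, Real.sq_sqrt hW0, pow_right_comm q k 2]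
    linarith
  rw [show -(k : ℝ) - 1 = -((k + 1 : ℕ) : ℝ) by push_cast; ring, Real.rpow_add hq0,
    Real.rpow_neg hq0.le, Real.rpow_natCast, lt_div_iff₀ hq0, pow_succ]
  calc (q ^ k * q)⁻¹ * q ^ besselAlpha ν q (k + 1) * q
      = (q ^ k)⁻¹ * q ^ besselAlpha ν q (k + 1) := by field_simp
    _ < (q ^ k)⁻¹ * (q ^ k * besselZero ν q k) := by gcongr
    _ = besselZero ν q k := by field_simp

theorem mainTheorem9 (q ν : ℝ) (hq0 : 0 < q) (hq1 : q < 1) (hν : -1 < ν) :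
    (∃ k₀ : ℕ, 0 < k₀ ∧ ∀ k : ℕ, k₀ ≤ k →
      besselZero ν q k = q ^ (-(k : ℝ) + besselZeroEps ν q k) ∧
      besselZeroEps ν q (k + 1) < besselZeroEps ν q k) ∧
    (∃ k₀ : ℕ, 0 < k₀ ∧ ∀ k : ℕ, k₀ ≤ k →
      besselZero ν q k / q ∈
        Set.Ioo (q ^ (-(k : ℝ) - 1 + besselAlpha ν q (k + 1))) (besselZero ν q (k + 1))) := by
  constructor
  · refine ⟨1, one_pos, fun k hk => ?_⟩
    obtain ⟨k, rfl⟩ := Nat.exists_eq_add_of_le' hk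
    exact ⟨besselZero_eq_rpow hq0 hq1 hν k, besselZeroEps_succ_lt hq0 hq1 hν k⟩
  · obtain ⟨K, hK⟩ := eventually_atTop.1 (eventually_rpow_lt_besselZero_div hq0 hq1 hν)
    exact ⟨K + 1, K.succ_pos, fun k hk =>
      ⟨hK k (by omega), besselZero_div_lt hq0 hq1 hν k⟩⟩
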